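/- **Setting.** Let $A$ be a complete lattice with order $\sqsubseteq$, let $G=(V,\to)$ be a finite directed graph, and let $(F_v)_{v\in V}$ be monotone functions $F_v:A^V\to A$ such that $F_v(\mathcal X)$ depends only on the values $\mathcal X(u)$ with $u\to v$ (so $G$ is the dependency graph of the equation system $\mathcal X(v)=F_v(\mathcal X)$, $v\in V$). Let $\triangledown:A\times A\to A$ be a function, and let $E\subseteq V$ be a set of entry vertices. **Weak partial orders.** A *weak partial order* (WPO) for $G$ is a tuple $(V,X,\rightharpoonup,\dashrightarrow)$ with $V\cap X=\emptyset$, $\rightharpoonup\,\subseteq (V\cup X)^2$ (scheduling constraints) and $\dashrightarrow\,\subseteq X\times V$ (stabilization constraints), such that, writing $\preceq$ for the reflexive transitive closure $\rightharpoonup^*$ and $\prec$ for its strict part: 1. every $x\in X$ has some $h\in V$ with $x\dashrightarrow h$; 2. $\preceq$ is a partial order on $V\cup X$; 3. $\dashrightarrow$ is one-to-one, i.e. each $x\in X$ has at most one $h$ with $x\dashrightarrow h$ and each $h$ at most one such $x$; and $x\dashrightarrow h$ implies $h\prec x$. For $x\dashrightarrow h$ the set $C_x=\{u : h\preceq u\preceq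 x\}$ is called the component with head $h$ and exit $x$; 4. any two components are disjoint or one contains the other; 5. if $u\in C_x$ and $u\preceq v$, then $x\prec v$ or $v\preceq x$; 6. if $u\to v$ in $G$, then $u\rightharpoonup^+ v$, or there is $x\in X$ with $x\dashrightarrow v$ and $u\in C_x$. Let a WPO for $G$ with $X$ finite be given, and assume moreover that $\rightharpoonup$ is irreflexive and that scheduling constraints leave a component only from its exit: if $u\in C_x$, $u\neq x$ and $u\rightharpoonup v$, then $v\in C_x$. **The algorithm.** Let $P(w)=|\{u: u\rightharpoonup w\}|$ and, for $w\in C_x$, $P_x(w)=|\{u\notin C_x: u\rightharpoonup w\}|$. The algorithm maintains a value map $\mathcal X:V\to A$ and a count map $\mathcal N:V\cup X\to\mathbb N$. - *Init* (once, at the beginning): $\mathcal X(v)=\top$ for $v\in E$ and $\mathcal X(v)=\bot$ for $v\in V\setminus E$; $\mathcal N(w)=0$ for all $w\in V\cup X$. - *NonExit*, applicable to $v\in V$ with $\mathcal N(v)=P(v)$: set $\mathcal N(v):=0$; compute $a=\mathcal X(v)\triangledown F_v(\mathcal X)$ if $v$ is a head and $a=F_v(\mathcal X)$ otherwise; set $\mathcal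 X(v):=a$; increment $\mathcal N(w)$ for all $w$ with $v\rightharpoonup w$. - *CompStabilized*, applicable to $x\in X$ with $\mathcal N(x)=P(x)$ and $F_h(\mathcal X)\sqsubseteq\mathcal X(h)$, where $x\dashrightarrow h$: set $\mathcal N(x):=0$; increment $\mathcal N(w)$ for all $w$ with $x\rightharpoonup w$. - *CompNotStabilized*, applicable to $x\in X$ with $\mathcal N(x)=P(x)$ and $F_h(\mathcal X)\not\sqsubseteq\mathcal X(h)$, where $x\dashrightarrow h$: set $\mathcal N(x):=0$; set $\mathcal N(w):=P_x(w)$ for all $w\in C_x$. Each time *Init*, an increment, or the last action of *CompNotStabilized* makes the count of an element $w$ equal to $P(w)$, the element becomes ready for exactly one rule application. Each of the actions listed in a rule, separated by semicolons, is atomic (the applicability test being made together with the first one); a rule application performs its actions in the listed order, and actions of rule applications at different elements may be interleaved arbitrarily. An *execution* is a finite or infinite sequence of actions starting after *Init*; it *terminates* in a state if no further action is possible there. **Theorem.** The algorithm is deterministic: (a) there is a post-fixpoint $\mathcal Y\in A^V$, i.e. $F_v(\mathcal Y)\sqsubseteq\mathcal Y(v)$ for all $v\in V$, which therefore lies above the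 least fixpoint of the equation system, such that every terminating execution, under any interleaving, ends with $\mathcal X=\mathcal Y$; (b) if some execution terminates, then there is no infinite execution; (c) if $\triangledown$ is a widening operator, i.e. $a\sqsubseteq a\triangledown b$ and $b\sqsubseteq a\triangledown b$ for all $a,b\in A$, and no sequence of the form $s_0=c_0$, $s_{n+1}=s_n\triangledown c_{n+1}$ with arbitrary $c_0,c_1,\ldots\in A$ is strictly increasing, then there is no infinite execution, so that every execution can be continued only to one that terminates with $\mathcal X=\mathcal Y$. -/

import Mathlib

open Relation

namespace ConcFix

/-- The component with head `h` and exit `x`: all `u` with `h ⪯ u ⪯ x`. -/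
def interval {S : Type*} (le : S → S → Prop) (h x : S) : Set S :=
  {u | le h u ∧ le u x}

/-- `(S, le, N)` is a hierarchical partial order. -/
structure IsHPO {S : Type*} (le : S → S → Prop) (N : S → S → Prop) : Prop where
  refl : ∀ a, le a a
  trans : ∀ a b c, le a b → le b c → le a c
  antisymm : ∀ a b, le a b → le b a → a = b
  /-- `N` is one-to-one, first half -/
  inj : ∀ x y h, N x h → N y h → x = y
  /-- `N` is one-to-one, second half -/
  func : ∀ x h k, N x h → N x k → h = k
  /-- `(x, h) ∈ N` implies `h ≺ x` -/
  head_lt_exit : ∀ x h, N x h → le h x ∧ h ≠ x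
  /-- the components are well nested: any two are disjoint or one contains the other -/
  nested : ∀ x h y k, N x h → N y k →
    Disjoint (interval le h x) (interval le k y) ∨
      interval le h x ⊆ interval le k y ∨ interval le k y ⊆ interval le h x
  /-- whatever lies above an element of a component is in it or strictly above its exit -/
  leave : ∀ h x u v, le h u → le u x → N x h → le u v → (le x v ∧ x ≠ v) ∨ le v x

/-- The data `(V, X, ⇀, ⇢)`; the disjoint union of `V` and `X` is the type `V ⊕ X`. -/
structure Tuple (V X : Type*) where
  /-- scheduling constraints `⇀` -/
  sched : V ⊕ X → V ⊕ X → Prop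
  /-- stabilization constraints `⇢`, from exits to their heads -/
  stab : X → V → Prop

namespace Tuple

variable {V X : Type*} (W : Tuple V X)

/-- `⇀*` -/
def le : V ⊕ X → V ⊕ X → Prop := ReflTransGen W.sched

/-- `⇢` as a relation on `V ⊕ X` -/
def nest : V ⊕ X → V ⊕ X → Prop :=
  fun a b => ∃ x h, a = Sum.inr x ∧ b = Sum.inl h ∧ W.stab x h

/-- The component `C_x` of the exit `x`. -/
def component (x : X) : Set (V ⊕ X) :=
  {u | ∃ h, W.stab x h ∧ u ∈ interval W.le (Sum.inl h) (Sum.inr x)}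

/-- `W` is a weak partial order for the directed graph `(V, G)`. -/
structure IsWPO (G : V → V → Prop) : Prop where
  exit_has_head : ∀ x, ∃ h, W.stab x h
  hpo : IsHPO W.le W.nest
  edge : ∀ u v, G u v → TransGen W.sched (Sum.inl u) (Sum.inl v) ∨
    ∃ x, Sum.inl u ∈ interval W.le (Sum.inl v) (Sum.inr x) ∧ W.stab x v

/-- The number of scheduling predecessors of `w`. -/
noncomputable def numSchedPreds (w : V ⊕ X) : ℕ :=
  {u | W.sched u w}.ncard

/-- The number of scheduling predecessors of `w ∈ C_x` that are not in `C_x`. -/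
noncomputable def numOuterSchedPreds (w : V ⊕ X) (x : X) : ℕ :=
  {u | W.sched u w ∧ u ∉ W.component x ∧ w ∈ W.component x}.ncard

end Tuple

/-- Progress of an element of `V ⊕ X`. It is `ready` from the moment its count is made equal to
its number of scheduling predecessors until a rule is applied to it; the later values say how far
that rule application has got. -/
inductive Phase (A : Type*) where
  | idle
  | ready
  /-- `NonExit`: count reset -/
  | reset
  /-- `NonExit`: new value computed, not yet written -/
  | evaluated (a : A)
  /-- `NonExit`: new value written -/
  | stored
  /-- `CompStabilized`: stabilization detected and count reset -/
  | stabilized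
  /-- `CompNotStabilized`: failed stabilization detected and count reset -/
  | notStabilized

/-- A state of the algorithm: value map, count map, progress of the elements. -/
structure State (V X A : Type*) where
  val : V → A
  cnt : V ⊕ X → ℕ
  phase : V ⊕ X → Phase A

section Algorithm

variable {V X A : Type*} (W : Tuple V X)

open Classical in
/-- Rule `Init`. -/
noncomputable def init [LE A] [BoundedOrder A] (entry : Set V) : State V X A where
  val v := if v ∈ entry then ⊤ else ⊥
  cnt _ := 0
  phase w := if W.numSchedPreds w = 0 then .ready else .idle

open Classical in
/-- The value that `ApplyF(v)` assigns to `v`: widening is used at component heads. -/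
noncomputable def newValue (F : V → (V → A) → A) (widen : A → A → A) (Y : V → A) (v : V) : A :=
  if ∃ x, W.stab x v then widen (Y v) (F v Y) else F v Y

/-- `ComponentStabilized(x)` -/
def ComponentStabilized [LE A] (F : V → (V → A) → A) (Y : V → A) (x : X) : Prop :=
  ∃ h, W.stab x h ∧ F h Y ≤ Y h

open Classical in
/-- End of the rule application at `e`: increment the counts of all scheduling successors; those
whose predecessors have now all been executed become ready. -/
noncomputable def notify (s : State V X A) (e : V ⊕ X) : State V X A where
  val := s.val
  cnt w := if W.sched e w then s.cnt w + 1 else s.cnt w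
  phase w :=
    if w = e then .idle
    else if W.sched e w ∧ s.cnt w + 1 = W.numSchedPreds w then .ready
    else s.phase w

open Classical in
/-- End of a `CompNotStabilized` application at `x`: `SetNForComponent(x)`; elements of the
component whose new count is their number of scheduling predecessors become ready. -/
noncomputable def restart (s : State V X A) (x : X) : State V X A where
  val := s.val
  cnt w := if w ∈ W.component x then W.numOuterSchedPreds w x else s.cnt w
  phase w :=
    if w ∈ W.component x ∧ W.numOuterSchedPreds w x = W.numSchedPreds w then .ready
    else if w = Sum.inr x then .idle
    else s.phase w

open Classical in
/-- One atomic action of the algorithm. A rule application at an element is the sequence of the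
actions listed in the rule; the actions of applications at different elements may be interleaved
arbitrarily. -/
inductive Step [LE A] (F : V → (V → A) → A) (widen : A → A → A) :
    State V X A → State V X A → Prop where
  | nonExitReset (s : State V X A) (v : V) :
      s.phase (Sum.inl v) = .ready →
      s.cnt (Sum.inl v) = W.numSchedPreds (Sum.inl v) →
      Step F widen s
        { s with
          cnt := Function.update s.cnt (Sum.inl v) 0
          phase := Function.update s.phase (Sum.inl v) .reset }
  | nonExitEval (s : State V X A) (v : V) :
      s.phase (Sum.inl v) = .reset →
      Step F widen s
        { s with
          phase := Function.update s.phase (Sum.inl v)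
            (.evaluated (newValue W F widen s.val v)) }
  | nonExitStore (s : State V X A) (v : V) (a : A) :
      s.phase (Sum.inl v) = .evaluated a →
      Step F widen s
        { s with
          val := Function.update s.val v a
          phase := Function.update s.phase (Sum.inl v) .stored }
  | nonExitNotify (s : State V X A) (v : V) :
      s.phase (Sum.inl v) = .stored →
      Step F widen s (notify W s (Sum.inl v))
  | compStabilizedReset (s : State V X A) (x : X) :
      s.phase (Sum.inr x) = .ready →
      s.cnt (Sum.inr x) = W.numSchedPreds (Sum.inr x) →
      ComponentStabilized W F s.val x →
      Step F widen s
        { s with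
          cnt := Function.update s.cnt (Sum.inr x) 0
          phase := Function.update s.phase (Sum.inr x) .stabilized }
  | compStabilizedNotify (s : State V X A) (x : X) :
      s.phase (Sum.inr x) = .stabilized →
      Step F widen s (notify W s (Sum.inr x))
  | compNotStabilizedReset (s : State V X A) (x : X) :
      s.phase (Sum.inr x) = .ready →
      s.cnt (Sum.inr x) = W.numSchedPreds (Sum.inr x) →
      ¬ ComponentStabilized W F s.val x →
      Step F widen s
        { s with
          cnt := Function.update s.cnt (Sum.inr x) 0
          phase := Function.update s.phase (Sum.inr x) .notStabilized }
  | compNotStabilizedSet (s : State V X A) (x : X) :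
      s.phase (Sum.inr x) = .notStabilized →
      Step F widen s (restart W s x)

/-- `s` is the last state of a complete finite execution: it is reached from the initial state and
no action is possible any more. -/
def IsFinal [LE A] [BoundedOrder A] (F : V → (V → A) → A) (widen : A → A → A) (entry : Set V)
    (s : State V X A) : Prop :=
  ReflTransGen (Step W F widen) (init W entry) s ∧ ∀ t, ¬ Step W F widen s t

/-- There is an execution that does not terminate. -/
def HasInfiniteExecution [LE A] [BoundedOrder A] (F : V → (V → A) → A) (widen : A → A → A)
    (entry : Set V) : Prop :=
  ∃ r : ℕ → State V X A, r 0 = init W entry ∧ ∀ n, Step W F widen (r n) (r (n + 1))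

end Algorithm

/-- Widening operator: an upper bound operator such that no sequence `s₀ = c₀`,
`sₙ₊₁ = sₙ ▽ cₙ₊₁` with arbitrary `c₀, c₁, …` is strictly increasing. -/
def IsWidening {A : Type*} [PartialOrder A] (widen : A → A → A) : Prop :=
  (∀ a b, a ≤ widen a b ∧ b ≤ widen a b) ∧
    ∀ c s : ℕ → A, s 0 = c 0 → (∀ n, s (n + 1) = widen (s n) (c (n + 1))) → ¬ StrictMono s

/-- The right-hand side of the equation system, as a monotone map. -/
def systemMap {V A : Type*} [CompleteLattice A] (F : V → (V → A) → A)
    (hF : ∀ v, Monotone (F v)) : (V → A) →o (V → A) where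
  toFun Y v := F v Y
  monotone' _ _ h v := hF v h

end ConcFix

/-!
Call a set `D ⊆ V ⊕ X` of executed elements closed if it contains the scheduling predecessors of
its elements, and active an element outside `D` all of whose scheduling predecessors lie in `D`.
In every reachable state the counts are determined by such a set `D` together with the progress of
the active elements, so an execution is a run of a machine in which every active element has
exactly one next action. A notification adds its element to `D`, a restart removes a component
from `D`.

Active elements form an antichain for `⪯`, whereas the elements `F_v` reads from are comparable
with `v`; so actions at different active elements commute, and the machine has the diamond
property. Hence there is at most one final state, and if there is one, no execution is infinite.
A run can only get stuck when everything has been executed, and every executed element is settled: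
`F_v(𝒳) ⊑ 𝒳(v)` holds at executed non-heads and at the heads of executed exits.

With a widening operator, a restart of the component of `h` is followed by a strict widening step
at `h`, and the values at heads can only be strictly widened finitely often.
-/

namespace ConcFix

section Diamond

variable {α : Type*} {r : α → α → Prop} {a b c : α}

/-- Diamond property below `a`: any two distinct steps from a point reachable from `a` can be
joined by one further step each. -/
def DiamondFrom (r : α → α → Prop) (a : α) : Prop :=
  ∀ ⦃b c d⦄, ReflTransGen r a b → r b c → r b d → c = d ∨ ∃ e, r c e ∧ r d e

theorem DiamondFrom.of_reflTransGen (h : DiamondFrom r a) (hab : ReflTransGen r a b) :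
    DiamondFrom r b :=
  fun _ _ _ hb => h (hab.trans hb)

theorem DiamondFrom.eq_of_normal (h : DiamondFrom r a) (hab : ReflTransGen r a b)
    (hb : ∀ d, ¬ r b d) (hac : ReflTransGen r a c) (hc : ∀ d, ¬ r c d) : b = c := by
  let reach x y := ReflTransGen r a x ∧ r x y
  have lift {x} (hx : ReflTransGen r a x) : ReflTransGen reach a x := by
    induction hx with
    | refl => exact .refl
    | tail hx hxy ih => exact ih.tail ⟨hx, hxy⟩
  have normal {x y} (hx : ∀ d, ¬ r x d) (hxy : ReflTransGen reach x y) : x = y := by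
    obtain rfl | ⟨d, ⟨-, hd⟩, -⟩ := ReflTransGen.cases_head hxy
    · rfl
    · exact absurd hd (hx d)
  obtain ⟨d, hbd, hcd⟩ : Join (ReflTransGen reach) b c := by
    refine church_rosser ?_ (lift hab) (lift hac)
    rintro x y z ⟨hx, hxy⟩ ⟨-, hxz⟩
    obtain rfl | ⟨d, hyd, hzd⟩ := h hx hxy hxz
    · exact ⟨y, .refl, .refl⟩
    · exact ⟨d, .single ⟨hx.tail hxy, hyd⟩, .single ⟨hx.tail hxz, hzd⟩⟩
  exact (normal hb hbd).trans (normal hc hcd).symm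

theorem DiamondFrom.acc_of_step (h : DiamondFrom r a) (hab : r a b) (hb : Acc (flip r) b) :
    Acc (flip r) a := by
  induction hb generalizing a with
  | intro b hb ih =>
    refine ⟨_, fun c hac => ?_⟩
    obtain rfl | ⟨d, hbd, hcd⟩ := h .refl hab hac
    · exact ⟨_, hb⟩
    · exact ih d hbd (h.of_reflTransGen (.single hac)) hcd

theorem DiamondFrom.acc_of_reflTransGen (h : DiamondFrom r a) (hab : ReflTransGen r a b)
    (hb : Acc (flip r) b) : Acc (flip r) a := by
  induction hab using ReflTransGen.head_induction_on with
  | refl => exact hb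
  | head hac _ ih => exact h.acc_of_step hac (ih (h.of_reflTransGen (.single hac)))

end Diamond

section WeakPartialOrder

variable {V X : Type*} {W : Tuple V X} {G : V → V → Prop} {x : X} {h k u v : V} {w e : V ⊕ X}

theorem Tuple.IsWPO.head_unique (hW : W.IsWPO G) (hh : W.stab x h) (hk : W.stab x k) : h = k :=
  Sum.inl_injective (hW.hpo.func _ _ _ ⟨x, h, rfl, rfl, hh⟩ ⟨x, k, rfl, rfl, hk⟩)

theorem Tuple.IsWPO.exit_unique {y : X} (hW : W.IsWPO G) (hx : W.stab x h) (hy : W.stab y h) :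
    x = y :=
  Sum.inr_injective (hW.hpo.inj _ _ _ ⟨x, h, rfl, rfl, hx⟩ ⟨y, h, rfl, rfl, hy⟩)

theorem Tuple.IsWPO.finite_exits [Finite V] (hW : W.IsWPO G) : Finite X := by
  choose head hhead using hW.exit_has_head
  exact Finite.of_injective head fun x y hxy => hW.exit_unique (hhead x) (hxy ▸ hhead y)

theorem Tuple.IsWPO.head_le_exit (hW : W.IsWPO G) (hx : W.stab x h) :
    W.le (.inl h) (.inr x) :=
  (hW.hpo.head_lt_exit _ _ ⟨x, h, rfl, rfl, hx⟩).1

theorem Tuple.IsWPO.mem_component_iff (hW : W.IsWPO G) (hx : W.stab x h) :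
    w ∈ W.component x ↔ W.le (.inl h) w ∧ W.le w (.inr x) := by
  refine ⟨?_, fun hw => ⟨h, hx, hw⟩⟩
  rintro ⟨k, hk, hw⟩
  rwa [hW.head_unique hx hk]

theorem Tuple.le_exit_of_mem_component (hw : w ∈ W.component x) : W.le w (.inr x) :=
  hw.choose_spec.2.2

theorem Tuple.IsWPO.exit_mem_component (hW : W.IsWPO G) (x : X) : .inr x ∈ W.component x := by
  obtain ⟨h, hx⟩ := hW.exit_has_head x
  exact ⟨h, hx, hW.head_le_exit hx, .refl⟩

theorem Tuple.IsWPO.head_mem_component (hW : W.IsWPO G) (hx : W.stab x h) :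
    .inl h ∈ W.component x :=
  ⟨h, hx, .refl, hW.head_le_exit hx⟩

theorem Tuple.IsWPO.notMem_component_of_sched_head (hW : W.IsWPO G)
    (hirrefl : ∀ a, ¬ W.sched a a) (hx : W.stab x h) (hw : W.sched w (.inl h)) :
    w ∉ W.component x := fun hmem => by
  have : Sum.inl h = w :=
    hW.hpo.antisymm _ _ ((hW.mem_component_iff hx).1 hmem).1 (.single hw)
  exact hirrefl _ (this ▸ hw)

theorem Tuple.IsWPO.not_transGen_self (hW : W.IsWPO G) (hirrefl : ∀ a, ¬ W.sched a a)
    (w : V ⊕ X) : ¬ TransGen W.sched w w := fun hww => by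
  obtain ⟨w', hw', hle⟩ := TransGen.head'_iff.1 hww
  have : w = w' := hW.hpo.antisymm _ _ (.single hw') hle
  exact hirrefl w' (this ▸ hw')

/-- The heads of components, where the algorithm widens. -/
def Tuple.IsHead (W : Tuple V X) (v : V) : Prop :=
  ∃ x, W.stab x v

theorem Tuple.IsWPO.le_of_edge (hW : W.IsWPO G) (huv : G u v) (hv : ¬ W.IsHead v) :
    W.le (.inl u) (.inl v) := by
  obtain hlt | ⟨x, -, hx⟩ := hW.edge u v huv
  · exact hlt.to_reflTransGen
  · exact absurd ⟨x, hx⟩ hv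

theorem Tuple.IsWPO.not_edge_self (hW : W.IsWPO G) (hirrefl : ∀ a, ¬ W.sched a a)
    (hv : ¬ W.IsHead v) : ¬ G v v := fun hvv => by
  obtain hlt | ⟨x, -, hx⟩ := hW.edge v v hvv
  · exact hW.not_transGen_self hirrefl _ hlt
  · exact hv ⟨x, hx⟩

theorem Tuple.IsWPO.le_or_le_of_edge (hW : W.IsWPO G) (huv : G u v) :
    W.le (.inl u) (.inl v) ∨ W.le (.inl v) (.inl u) := by
  obtain hlt | ⟨x, hu, -⟩ := hW.edge u v huv
  · exact .inl hlt.to_reflTransGen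
  · exact .inr hu.1

theorem Tuple.IsWPO.le_exit_of_edge (hW : W.IsWPO G) (hx : W.stab x h) (huh : G u h) :
    W.le (.inl u) (.inr x) := by
  obtain hlt | ⟨y, hu, hy⟩ := hW.edge u h huh
  · exact hlt.to_reflTransGen.trans (hW.head_le_exit hx)
  · exact hW.exit_unique hy hx ▸ hu.2

end WeakPartialOrder

section Scheduling

variable {V X : Type*} {W : Tuple V X} {G : V → V → Prop} {D : Set (V ⊕ X)} {u w e e' : V ⊕ X}
  {x : X}

/-- Scheduling constraints leave a component only from its exit. -/
def Tuple.LeavesOnlyFromExits (W : Tuple V X) : Prop :=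
  ∀ (x : X) (u v : V ⊕ X),
    u ∈ W.component x → u ≠ Sum.inr x → W.sched u v → v ∈ W.component x

/-- The sets of executed elements that occur in the algorithm contain, with any element, its
scheduling predecessors. -/
def Tuple.IsPredClosed (W : Tuple V X) (D : Set (V ⊕ X)) : Prop :=
  ∀ ⦃u w⦄, W.sched u w → w ∈ D → u ∈ D

/-- The elements that can be executed next, when those of `D` have been executed. -/
def Tuple.active (W : Tuple V X) (D : Set (V ⊕ X)) : Set (V ⊕ X) :=
  {w | w ∉ D ∧ ∀ u, W.sched u w → u ∈ D}

theorem Tuple.IsPredClosed.mem_of_le (hD : W.IsPredClosed D) (huw : W.le u w) (hw : w ∈ D) :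
    u ∈ D := by
  induction huw using ReflTransGen.head_induction_on with
  | refl => exact hw
  | head huc _ ih => exact hD huc ih

theorem Tuple.IsPredClosed.mem_of_le_active (hD : W.IsPredClosed D) (he : e ∈ W.active D)
    (hue : W.le u e) (hne : u ≠ e) : u ∈ D := by
  obtain rfl | ⟨w, huw, hwe⟩ := ReflTransGen.cases_tail hue
  · exact absurd rfl hne
  · exact hD.mem_of_le huw (he.2 w hwe)

theorem Tuple.IsPredClosed.eq_of_le_active (hD : W.IsPredClosed D) (he : e ∈ W.active D)
    (he' : e' ∈ W.active D) (hle : W.le e e') : e = e' :=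
  by_contra fun hne => he.1 (hD.mem_of_le_active he' hle hne)

theorem Tuple.IsPredClosed.eq_exit_of_mem_component (hD : W.IsPredClosed D) (he : e ∈ W.active D)
    (hx : .inr x ∈ W.active D) (hmem : e ∈ W.component x) : e = .inr x :=
  hD.eq_of_le_active he hx (Tuple.le_exit_of_mem_component hmem)

theorem Tuple.IsPredClosed.insert (hD : W.IsPredClosed D) (he : e ∈ W.active D) :
    W.IsPredClosed (insert e D) := by
  rintro u w huw (rfl | hw)
  · exact .inr (he.2 u huw)
  · exact .inr (hD huw hw)

theorem Tuple.IsPredClosed.diff_component (hD : W.IsPredClosed D) (hW : W.IsWPO G)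
    (hx : .inr x ∉ D) : W.IsPredClosed (D \ W.component x) := by
  rintro u w huw ⟨hw, hwx⟩
  refine ⟨hD huw hw, fun ⟨h, hxh, hu⟩ => ?_⟩
  obtain ⟨hxw, -⟩ | hwx' := hW.hpo.leave _ _ u w hu.1 hu.2 ⟨x, h, rfl, rfl, hxh⟩ (.single huw)
  · exact hx (hD.mem_of_le hxw hw)
  · exact hwx ⟨h, hxh, hu.1.tail huw, hwx'⟩

theorem Tuple.active_insert_of_ne (he' : e' ∈ W.active D) (hne : e' ≠ e) :
    e' ∈ W.active (insert e D) :=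
  ⟨not_or.2 ⟨hne, he'.1⟩, fun u hu => .inr (he'.2 u hu)⟩

theorem Tuple.IsPredClosed.active_diff_component (hD : W.IsPredClosed D)
    (hleave : W.LeavesOnlyFromExits) (hx : .inr x ∈ W.active D) (he : e ∈ W.active D)
    (hne : e ≠ .inr x) : e ∈ W.active (D \ W.component x) := by
  refine ⟨fun hmem => he.1 hmem.1, fun u hu => ⟨he.2 u hu, fun hux => ?_⟩⟩
  have hux' : u ≠ .inr x := fun heq => hx.1 (heq ▸ he.2 u hu)
  exact hne (hD.eq_exit_of_mem_component he hx (hleave x u e hux hux' hu))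

theorem Tuple.IsPredClosed.head_active_diff_component (hD : W.IsPredClosed D) (hW : W.IsWPO G)
    (hirrefl : ∀ a, ¬ W.sched a a) (hx : .inr x ∈ W.active D) {h : V} (hxh : W.stab x h) :
    .inl h ∈ W.active (D \ W.component x) := by
  refine ⟨fun hmem => hmem.2 (hW.head_mem_component hxh), fun u hu => ⟨?_, ?_⟩⟩
  · exact hD hu (hD.mem_of_le_active hx (hW.head_le_exit hxh) Sum.inl_ne_inr)
  · exact hW.notMem_component_of_sched_head hirrefl hxh hu

/-- The number of executed scheduling predecessors of `w`, when the executed elements are those of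
`D`; this is the count that the algorithm maintains. -/
noncomputable def Tuple.numDonePreds (W : Tuple V X) (D : Set (V ⊕ X)) (w : V ⊕ X) : ℕ :=
  {u | W.sched u w ∧ u ∈ D}.ncard

theorem Tuple.mem_active_iff_numDonePreds_eq [Finite V] [Finite X] (hw : w ∉ D) :
    w ∈ W.active D ↔ W.numDonePreds D w = W.numSchedPreds w := by
  refine (and_iff_right hw).trans ⟨fun h => ?_, fun h u hu => ?_⟩
  · exact congrArg Set.ncard (Set.ext fun u => and_iff_left_of_imp (h u))
  · have hsub : {u | W.sched u w ∧ u ∈ D} ⊆ {u | W.sched u w} := fun _ hu => hu.1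
    exact ((Set.eq_of_subset_of_ncard_le hsub h.ge).ge hu).2

theorem Tuple.numDonePreds_insert_of_sched [Finite V] [Finite X] (he : e ∉ D)
    (hew : W.sched e w) : W.numDonePreds (insert e D) w = W.numDonePreds D w + 1 := by
  have hinsert : {u | W.sched u w ∧ u ∈ insert e D} = insert e {u | W.sched u w ∧ u ∈ D} := by
    ext u
    constructor
    · rintro ⟨hu, rfl | huD⟩
      exacts [.inl rfl, .inr ⟨hu, huD⟩]
    · rintro (rfl | ⟨hu, huD⟩)
      exacts [⟨hew, .inl rfl⟩, ⟨hu, .inr huD⟩]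
  rw [numDonePreds, hinsert, Set.ncard_insert_of_notMem fun hmem => he hmem.2, numDonePreds]

theorem Tuple.mem_insert_iff_of_sched (hew : ¬ W.sched e w) {u : V ⊕ X} (huw : W.sched u w) :
    u ∈ insert e D ↔ u ∈ D :=
  or_iff_right fun heq => hew (heq ▸ huw)

theorem Tuple.numDonePreds_insert_of_not_sched (hew : ¬ W.sched e w) :
    W.numDonePreds (insert e D) w = W.numDonePreds D w :=
  congrArg Set.ncard <| Set.ext fun _ => and_congr_right (mem_insert_iff_of_sched hew)

theorem Tuple.mem_active_insert_iff (hne : w ≠ e) (hew : ¬ W.sched e w) :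
    w ∈ W.active (insert e D) ↔ w ∈ W.active D :=
  and_congr (not_congr (or_iff_right hne))
    (forall₂_congr fun _ => mem_insert_iff_of_sched hew)

theorem Tuple.numDonePreds_diff_component_of_mem (hD : W.IsPredClosed D) (hW : W.IsWPO G)
    (hx : .inr x ∈ W.active D) (hw : w ∈ W.component x) :
    W.numDonePreds (D \ W.component x) w = W.numOuterSchedPreds w x := by
  refine congrArg Set.ncard (Set.ext fun u => and_congr_right fun huw => ?_)
  refine ⟨fun hu => ⟨hu.2, hw⟩, fun hu => ⟨?_, hu.1⟩⟩
  have hne : u ≠ .inr x := fun heq => hu.1 (heq ▸ hW.exit_mem_component x)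
  exact hD.mem_of_le_active hx ((Tuple.le_exit_of_mem_component hw).head huw) hne

theorem Tuple.mem_diff_component_iff_of_sched (hleave : W.LeavesOnlyFromExits)
    (hx : .inr x ∉ D) (hw : w ∉ W.component x) (huw : W.sched u w) :
    u ∈ D \ W.component x ↔ u ∈ D := by
  refine ⟨fun hu => hu.1, fun hu => ⟨hu, fun hux => hw ?_⟩⟩
  exact hleave x u w hux (fun heq => hx (heq ▸ hu)) huw

theorem Tuple.numDonePreds_diff_component_of_notMem (hleave : W.LeavesOnlyFromExits)
    (hx : .inr x ∉ D) (hw : w ∉ W.component x) :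
    W.numDonePreds (D \ W.component x) w = W.numDonePreds D w :=
  congrArg Set.ncard <| Set.ext fun _ =>
    and_congr_right (mem_diff_component_iff_of_sched hleave hx hw)

theorem Tuple.mem_active_diff_component_iff (hleave : W.LeavesOnlyFromExits)
    (hx : .inr x ∉ D) (hw : w ∉ W.component x) :
    w ∈ W.active (D \ W.component x) ↔ w ∈ W.active D :=
  and_congr (not_congr (and_iff_left hw))
    (forall₂_congr fun _ => mem_diff_component_iff_of_sched hleave hx hw)

theorem Tuple.IsWPO.eq_univ_of_active_eq_empty [Finite V] (hW : W.IsWPO G)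
    (hirrefl : ∀ a, ¬ W.sched a a) (hD : W.active D = ∅) : D = Set.univ := by
  have : Finite X := hW.finite_exits
  have : Std.Irrefl (TransGen W.sched) := ⟨hW.not_transGen_self hirrefl⟩
  have hwf : WellFounded (TransGen W.sched) := Finite.wellFounded_of_trans_of_irrefl _
  refine Set.eq_univ_of_forall fun w => hwf.induction w fun w ih => ?_
  by_contra hw
  exact Set.notMem_empty w (hD ▸ ⟨hw, fun u hu => ih u (.single hu)⟩)

end Scheduling

section Reading

variable {V X A : Type*} {W : Tuple V X} {G : V → V → Prop} {F : V → (V → A) → A}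
  {widen : A → A → A} {Y : V → A} {u v : V} {x : X} {w : V ⊕ X} {a : A}

theorem apply_update_of_not_edge (hdep : ∀ v, DependsOn (F v) {u | G u v}) [DecidableEq V]
    (huv : ¬ G u v) : F v (Function.update Y u a) = F v Y :=
  hdep v fun _ hk => Function.update_of_ne (fun heq => huv (by rwa [← heq])) a Y

theorem newValue_update (hW : W.IsWPO G) (hdep : ∀ v, DependsOn (F v) {u | G u v})
    [DecidableEq V] (huv : ¬ W.le (.inl u) (.inl v)) (hvu : ¬ W.le (.inl v) (.inl u)) :
    newValue W F widen (Function.update Y u a) v = newValue W F widen Y v := by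
  have hedge : ¬ G u v := fun hG => (hW.le_or_le_of_edge hG).elim huv hvu
  have hne : v ≠ u := fun heq => huv (heq ▸ .refl)
  simp only [newValue, apply_update_of_not_edge hdep hedge, Function.update_of_ne hne]

/-- What the execution of an element achieves: a non-head is a post-fixpoint of its equation, and
so is the head of the component of an exit. -/
def Settled [LE A] (W : Tuple V X) (F : V → (V → A) → A) (Y : V → A) : V ⊕ X → Prop
  | .inl v => ¬ W.IsHead v → F v Y ≤ Y v
  | .inr x => ComponentStabilized W F Y x

theorem componentStabilized_iff [LE A] (hW : W.IsWPO G) {h : V} (hx : W.stab x h) :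
    ComponentStabilized W F Y x ↔ F h Y ≤ Y h := by
  refine ⟨?_, fun hY => ⟨h, hx, hY⟩⟩
  rintro ⟨k, hk, hY⟩
  rwa [hW.head_unique hx hk]

theorem settled_update [LE A] (hW : W.IsWPO G) (hdep : ∀ v, DependsOn (F v) {u | G u v})
    [DecidableEq V] (huw : ¬ W.le (.inl u) w) :
    Settled W F (Function.update Y u a) w ↔ Settled W F Y w := by
  rcases w with v | x
  · refine forall_congr' fun hv => ?_
    have hne : v ≠ u := fun heq => huw (heq ▸ .refl)
    rw [apply_update_of_not_edge hdep fun hG => huw (hW.le_of_edge hG hv),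
      Function.update_of_ne hne]
  · obtain ⟨h, hx⟩ := hW.exit_has_head x
    have hne : h ≠ u := fun heq => huw (heq ▸ hW.head_le_exit hx)
    simp only [Settled, componentStabilized_iff hW hx, Function.update_of_ne hne,
      apply_update_of_not_edge hdep fun hG => huw (hW.le_exit_of_edge hx hG)]

theorem le_of_forall_settled [LE A] (hW : W.IsWPO G) (hY : ∀ w, Settled W F Y w) (v : V) :
    F v Y ≤ Y v := by
  by_cases hv : W.IsHead v
  · obtain ⟨x, hx⟩ := hv
    exact (componentStabilized_iff hW hx).1 (hY (.inr x))
  · exact hY (.inl v) hv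

end Reading

section Actions

variable {V X A : Type*} {W : Tuple V X} {G : V → V → Prop} {F : V → (V → A) → A}
  {widen : A → A → A} {Y : V → A} {D : Set (V ⊕ X)} {e e' w : V ⊕ X} {p q : Phase A}

open Classical in
/-- The phase after the next action at an element in a given phase. A completed rule application
leads back to `ready`, the phase with which the next application at the element will start. -/
noncomputable def nextPhase [LE A] (W : Tuple V X) (F : V → (V → A) → A) (widen : A → A → A)
    (Y : V → A) : V ⊕ X → Phase A → Phase A
  | .inl _, .ready => .reset
  | .inl v, .reset => .evaluated (newValue W F widen Y v)
  | .inl _, .evaluated _ => .stored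
  | .inr x, .ready => if ComponentStabilized W F Y x then .stabilized else .notStabilized
  | _, _ => .ready

open Classical in
/-- The values after the next action at an element in a given phase. -/
noncomputable def nextVal (Y : V → A) : V ⊕ X → Phase A → V → A
  | .inl v, .evaluated a => Function.update Y v a
  | _, _ => Y

/-- The executed elements after the next action at an element in a given phase. -/
def nextDone (W : Tuple V X) (D : Set (V ⊕ X)) : V ⊕ X → Phase A → Set (V ⊕ X)
  | .inl v, .stored => insert (.inl v) D
  | .inr x, .stabilized => insert (.inr x) D
  | .inr x, .notStabilized => D \ W.component x
  | _, _ => D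

/-- The phases that an active element can be in, together with what is known about the values
in them. -/
inductive SoundPhase [LE A] (W : Tuple V X) (F : V → (V → A) → A) (widen : A → A → A)
    (Y : V → A) : V ⊕ X → Phase A → Prop
  | ready (e : V ⊕ X) : SoundPhase W F widen Y e .ready
  | reset (v : V) : SoundPhase W F widen Y (.inl v) .reset
  | evaluated (v : V) : SoundPhase W F widen Y (.inl v) (.evaluated (newValue W F widen Y v))
  | stored (v : V) : Settled W F Y (.inl v) → SoundPhase W F widen Y (.inl v) .stored
  | stabilized (x : X) : Settled W F Y (.inr x) → SoundPhase W F widen Y (.inr x) .stabilized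
  | notStabilized (x : X) :
      ¬ Settled W F Y (.inr x) → SoundPhase W F widen Y (.inr x) .notStabilized

theorem nextVal_apply_of_ne {v : V} (hv : e ≠ .inl v) : nextVal Y e p v = Y v := by
  classical
  unfold nextVal
  split
  · exact Function.update_of_ne (fun heq => hv (congrArg _ heq.symm)) _ _
  · rfl

theorem nextDone_eq_self [LE A] (h : nextPhase W F widen Y e p ≠ .ready) :
    nextDone W D e p = D := by
  rcases e with v | x <;> cases p <;> first | rfl | exact absurd rfl h

theorem nextVal_comm (hne : e ≠ e') :
    nextVal (nextVal Y e p) e' q = nextVal (nextVal Y e' q) e p := by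
  classical
  unfold nextVal
  rcases e with v | x <;> rcases e' with v' | x' <;> cases p <;> cases q <;> try rfl
  exact Function.update_comm (fun heq => hne (congrArg _ heq)) _ _ _

theorem apply_nextVal (hW : W.IsWPO G) (hdep : ∀ v, DependsOn (F v) {u | G u v}) {v : V}
    (hle : ¬ W.le e (.inl v)) (hle' : ¬ W.le (.inl v) e) : F v (nextVal Y e p) = F v Y := by
  classical
  unfold nextVal
  split
  · exact apply_update_of_not_edge hdep fun hG => (hW.le_or_le_of_edge hG).elim hle hle'
  · rfl

theorem nextPhase_nextVal [LE A] (hW : W.IsWPO G) (hdep : ∀ v, DependsOn (F v) {u | G u v})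
    (hle : ¬ W.le e e') (hle' : ¬ W.le e' e) :
    nextPhase W F widen (nextVal Y e p) e' q = nextPhase W F widen Y e' q := by
  classical
  unfold nextVal
  split
  · rcases e' with v' | x' <;> cases q <;> try rfl
    · exact congrArg Phase.evaluated (newValue_update hW hdep hle hle')
    · exact if_congr (settled_update (w := .inr x') hW hdep hle) rfl rfl
  · rfl

theorem settled_nextVal [LE A] (hW : W.IsWPO G) (hdep : ∀ v, DependsOn (F v) {u | G u v})
    (hle : ¬ W.le e w) : Settled W F (nextVal Y e p) w ↔ Settled W F Y w := by
  classical
  unfold nextVal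
  split
  · exact settled_update hW hdep hle
  · rfl

theorem soundPhase_nextVal [LE A] (hW : W.IsWPO G) (hdep : ∀ v, DependsOn (F v) {u | G u v})
    (hle : ¬ W.le e e') (hle' : ¬ W.le e' e) (h : SoundPhase W F widen Y e' q) :
    SoundPhase W F widen (nextVal Y e p) e' q := by
  have hsettled := settled_nextVal (F := F) (Y := Y) (p := p) hW hdep hle
  cases h with
  | ready => exact .ready _
  | reset v => exact .reset v
  | evaluated v =>
    have := nextPhase_nextVal (widen := widen) (Y := Y) (p := p) (q := .reset) hW hdep hle hle'
    exact Phase.evaluated.inj this ▸ .evaluated v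
  | stored v hv => exact .stored v (hsettled.2 hv)
  | stabilized x hx => exact .stabilized x (hsettled.2 hx)
  | notStabilized x hx => exact .notStabilized x (hsettled.not.2 hx)

theorem nextDone_comm (hD : W.IsPredClosed D) (he : e ∈ W.active D) (he' : e' ∈ W.active D)
    (hne : e ≠ e') : nextDone W (nextDone W D e p) e' q = nextDone W (nextDone W D e' q) e p := by
  have insert_diff {e : V ⊕ X} {x : X} (he : e ∈ W.active D) (hx : .inr x ∈ W.active D)
      (hex : e ≠ .inr x) : insert e (D \ W.component x) = insert e D \ W.component x :=
    (Set.insert_sdiff_of_notMem _ fun hmem => hex (hD.eq_exit_of_mem_component he hx hmem)).symm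
  unfold nextDone
  rcases e with v | x <;> rcases e' with v' | x' <;> cases p <;> cases q <;> try rfl
  all_goals first
    | exact Set.insert_comm _ _ _
    | exact (insert_diff he he' hne).symm
    | exact insert_diff he' he hne.symm
    | exact Set.sdiff_sdiff_comm

end Actions

section Machine

variable {V X A : Type*} {W : Tuple V X} {G : V → V → Prop} {F : V → (V → A) → A}
  {widen : A → A → A} {entry : Set V} {e e' : V ⊕ X}

/-- A configuration of the abstract machine: the values, the set of executed elements, and the
phases of the active elements. All other elements are kept in phase `ready`, so that they are in
the right phase when they become active. -/
structure Config (V X A : Type*) where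
  val : V → A
  done : Set (V ⊕ X)
  phase : V ⊕ X → Phase A

open Classical in
/-- The machine performs the next action at `e`. -/
noncomputable def Config.act [LE A] (W : Tuple V X) (F : V → (V → A) → A) (widen : A → A → A)
    (c : Config V X A) (e : V ⊕ X) : Config V X A where
  val := nextVal c.val e (c.phase e)
  done := nextDone W c.done e (c.phase e)
  phase := Function.update c.phase e (nextPhase W F widen c.val e (c.phase e))

open Classical in
/-- The configuration after rule `Init`. -/
noncomputable def Config.start [LE A] [BoundedOrder A] (entry : Set V) : Config V X A where
  val v := if v ∈ entry then ⊤ else ⊥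
  done := ∅
  phase _ := .ready

/-- The configurations that occur in executions. -/
structure Config.Valid [LE A] (W : Tuple V X) (F : V → (V → A) → A) (widen : A → A → A)
    (c : Config V X A) : Prop where
  isPredClosed : W.IsPredClosed c.done
  ready_of_notMem_active : ∀ w ∉ W.active c.done, c.phase w = .ready
  sound : ∀ w, SoundPhase W F widen c.val w (c.phase w)
  settled : ∀ w ∈ c.done, Settled W F c.val w

variable {c : Config V X A}

theorem Config.Valid.start [LE A] [BoundedOrder A] :
    (Config.start entry : Config V X A).Valid W F widen where
  isPredClosed _ _ _ h := h
  ready_of_notMem_active _ _ := rfl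
  sound _ := .ready _
  settled _ h := absurd h (Set.notMem_empty _)

theorem Config.Valid.not_le [LE A] (hc : c.Valid W F widen) (he : e ∈ W.active c.done)
    (he' : e' ∈ W.active c.done) (hne : e ≠ e') : ¬ W.le e e' :=
  fun hle => hne (hc.isPredClosed.eq_of_le_active he he' hle)

theorem Config.act_phase_of_ne [LE A] (hne : e' ≠ e) :
    (c.act W F widen e).phase e' = c.phase e' := by
  classical exact Function.update_of_ne hne _ _

theorem Config.Valid.act_comm [LE A] (hc : c.Valid W F widen) (hW : W.IsWPO G)
    (hdep : ∀ v, DependsOn (F v) {u | G u v}) (he : e ∈ W.active c.done)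
    (he' : e' ∈ W.active c.done) (hne : e ≠ e') :
    (c.act W F widen e).act W F widen e' = (c.act W F widen e').act W F widen e := by
  classical
  have hle := hc.not_le he he' hne
  have hle' := hc.not_le he' he hne.symm
  rw [Config.act, Config.act.eq_def W F widen (c.act W F widen e'), act_phase_of_ne hne,
    act_phase_of_ne hne.symm, Config.mk.injEq]
  refine ⟨nextVal_comm hne, nextDone_comm hc.isPredClosed he he' hne, ?_⟩
  simp only [Config.act, nextPhase_nextVal hW hdep hle hle', nextPhase_nextVal hW hdep hle' hle]
  exact Function.update_comm hne _ _ _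

theorem Config.Valid.active_act [LE A] (hc : c.Valid W F widen)
    (hleave : W.LeavesOnlyFromExits) (he : e ∈ W.active c.done) (he' : e' ∈ W.active c.done)
    (hne : e' ≠ e) : e' ∈ W.active (c.act W F widen e).done := by
  change e' ∈ W.active (nextDone W c.done e (c.phase e))
  unfold nextDone
  split
  · exact Tuple.active_insert_of_ne he' hne
  · exact Tuple.active_insert_of_ne he' hne
  · exact hc.isPredClosed.active_diff_component hleave he he' hne
  · exact he'

theorem Config.Valid.isPredClosed_act [LE A] (hc : c.Valid W F widen) (hW : W.IsWPO G)
    (he : e ∈ W.active c.done) : W.IsPredClosed (c.act W F widen e).done := by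
  change W.IsPredClosed (nextDone W c.done e (c.phase e))
  unfold nextDone
  split
  · exact hc.isPredClosed.insert he
  · exact hc.isPredClosed.insert he
  · exact hc.isPredClosed.diff_component hW he.1
  · exact hc.isPredClosed

theorem SoundPhase.nextPhase [Preorder A] {Y : V → A} {p : Phase A} (hW : W.IsWPO G)
    (hirrefl : ∀ a, ¬ W.sched a a) (hdep : ∀ v, DependsOn (F v) {u | G u v})
    (h : SoundPhase W F widen Y e p) :
    SoundPhase W F widen (nextVal Y e p) e (nextPhase W F widen Y e p) := by
  classical
  cases h with
  | ready e =>
    rcases e with v | x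
    · exact .reset v
    · by_cases hx : ComponentStabilized W F Y x
      · simpa only [ConcFix.nextPhase, if_pos hx] using .stabilized x hx
      · simpa only [ConcFix.nextPhase, if_neg hx] using .notStabilized x hx
  | reset v => exact .evaluated v
  | evaluated v =>
    refine .stored v fun hv => ?_
    have hnew : newValue W F widen Y v = F v Y := if_neg hv
    simp only [nextVal, apply_update_of_not_edge hdep (hW.not_edge_self hirrefl hv),
      Function.update_self, hnew, le_refl]
  | stored | stabilized | notStabilized => exact .ready _

theorem SoundPhase.settled_of_mem_nextDone [LE A] {Y : V → A} {p : Phase A} {D : Set (V ⊕ X)}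
    {w : V ⊕ X} (h : SoundPhase W F widen Y e p) (hD : ∀ w ∈ D, Settled W F (nextVal Y e p) w)
    (hw : w ∈ nextDone W D e p) : Settled W F (nextVal Y e p) w := by
  cases h with
  | ready e => exact hD w (by rcases e with v | x <;> exact hw)
  | reset | evaluated => exact hD w hw
  | stored v hv =>
    rcases hw with rfl | hw
    exacts [hv, hD w hw]
  | stabilized x hx =>
    rcases hw with rfl | hw
    exacts [hx, hD w hw]
  | notStabilized => exact hD w hw.1

theorem Config.Valid.act [Preorder A] (hc : c.Valid W F widen) (hW : W.IsWPO G)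
    (hirrefl : ∀ a, ¬ W.sched a a) (hleave : W.LeavesOnlyFromExits)
    (hdep : ∀ v, DependsOn (F v) {u | G u v}) (he : e ∈ W.active c.done) :
    (c.act W F widen e).Valid W F widen where
  isPredClosed := hc.isPredClosed_act hW he
  ready_of_notMem_active w hw := by
    by_cases hwe : w = e
    · subst hwe
      by_contra hready
      have hnext : nextPhase W F widen c.val w (c.phase w) ≠ .ready := by
        simpa only [Config.act, Function.update_self] using hready
      exact hw (by simpa only [Config.act, nextDone_eq_self hnext] using he)
    · rw [act_phase_of_ne hwe]
      exact hc.ready_of_notMem_active w fun hmem => hw (hc.active_act hleave he hmem hwe)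
  sound w := by
    by_cases hwe : w = e
    · subst hwe
      simpa only [Config.act, Function.update_self] using (hc.sound w).nextPhase hW hirrefl hdep
    rw [act_phase_of_ne hwe]
    by_cases hw : w ∈ W.active c.done
    · exact soundPhase_nextVal hW hdep (hc.not_le he hw (Ne.symm hwe)) (hc.not_le hw he hwe)
        (hc.sound w)
    · exact hc.ready_of_notMem_active w hw ▸ .ready w
  settled w hw := by
    refine (hc.sound e).settled_of_mem_nextDone (fun w hw => ?_) hw
    have hle : ¬ W.le e w := fun hle => he.1 (hc.isPredClosed.mem_of_le hle hw)
    exact (settled_nextVal hW hdep hle).2 (hc.settled w hw)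

open Classical in
/-- The state of the algorithm represented by a configuration: an element that has been executed,
or whose execution has begun, has count `0`, and all other counts are the numbers of executed
scheduling predecessors. -/
noncomputable def Config.toState (W : Tuple V X) (c : Config V X A) : State V X A where
  val := c.val
  cnt w := if w ∈ c.done ∨ c.phase w ≠ .ready then 0 else W.numDonePreds c.done w
  phase w := if w ∈ W.active c.done then c.phase w else .idle

theorem Config.toState_start [Finite V] [Finite X] [LE A] [BoundedOrder A] :
    (Config.start entry).toState W = (init W entry : State V X A) := by
  have hactive (w : V ⊕ X) : w ∈ W.active ∅ ↔ W.numSchedPreds w = 0 := by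
    simp [Tuple.mem_active_iff_numDonePreds_eq (Set.notMem_empty w), Tuple.numDonePreds, eq_comm]
  simp [Config.toState, Config.start, init, hactive, Tuple.numDonePreds]

theorem Config.toState_phase_of_active (he : e ∈ W.active c.done) :
    (c.toState W).phase e = c.phase e :=
  if_pos he

theorem Config.toState_cnt_of_notMem (he : e ∉ c.done) (hready : c.phase e = .ready) :
    (c.toState W).cnt e = W.numDonePreds c.done e :=
  if_neg (not_or.2 ⟨he, not_not.2 hready⟩)

theorem Config.toState_cnt_of_active [Finite V] [Finite X] (he : e ∈ W.active c.done)
    (hready : c.phase e = .ready) : (c.toState W).cnt e = W.numSchedPreds e :=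
  (toState_cnt_of_notMem he.1 hready).trans ((Tuple.mem_active_iff_numDonePreds_eq he.1).1 he)

open Classical in
theorem Config.toState_advance {Y : V → A} {p : Phase A} (he : e ∈ W.active c.done)
    (hp : p ≠ .ready) :
    Config.toState W ⟨Y, c.done, Function.update c.phase e p⟩ =
      { val := Y
        cnt := Function.update (c.toState W).cnt e 0
        phase := Function.update (c.toState W).phase e p } := by
  refine congrArg₂ (State.mk Y) (funext fun w => ?_) (funext fun w => ?_) <;>
    obtain rfl | hw := eq_or_ne w e <;> simp [Config.toState, *]

open Classical in
theorem Config.toState_advance_of_ne_ready {Y : V → A} {p : Phase A} (he : e ∈ W.active c.done)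
    (hpe : c.phase e ≠ .ready) (hp : p ≠ .ready) :
    Config.toState W ⟨Y, c.done, Function.update c.phase e p⟩ =
      { val := Y
        cnt := (c.toState W).cnt
        phase := Function.update (c.toState W).phase e p } := by
  have hcnt : 0 = (c.toState W).cnt e := (if_pos (.inr hpe)).symm
  rw [toState_advance he hp, Function.update_eq_self_iff.2 hcnt]

open Classical in
theorem Config.Valid.toState_insert [Finite V] [Finite X] [LE A] (hc : c.Valid W F widen)
    (he : e ∈ W.active c.done) (hp : c.phase e ≠ .ready) :
    Config.toState W ⟨c.val, insert e c.done, Function.update c.phase e .ready⟩ =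
      notify W (c.toState W) e := by
  have hself : ¬ W.sched e e := fun hee => he.1 (he.2 e hee)
  refine congrArg₂ (State.mk c.val) (funext fun w => ?_) (funext fun w => ?_) <;>
    by_cases hew : W.sched e w <;> obtain rfl | hwe := eq_or_ne w e
  · exact absurd hew hself
  · have hw : w ∉ c.done := fun hw => he.1 (hc.isPredClosed hew hw)
    have hready := hc.ready_of_notMem_active w fun hw => he.1 (hw.2 e hew)
    simp [toState, hew, hwe, hw, hready, Tuple.numDonePreds_insert_of_sched he.1]
  · simp [toState, hself, hp]
  · simp [toState, hew, hwe, Tuple.numDonePreds_insert_of_not_sched hew]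
  · exact absurd hew hself
  · have hw : w ∉ c.done := fun hw => he.1 (hc.isPredClosed hew hw)
    have hactive : w ∉ W.active c.done := fun hw => he.1 (hw.2 e hew)
    have hready := hc.ready_of_notMem_active w hactive
    have hactive' : w ∈ W.active (insert e c.done) ↔
        W.numDonePreds c.done w + 1 = W.numSchedPreds w := by
      rw [Tuple.mem_active_iff_numDonePreds_eq (D := insert e c.done) (not_or.2 ⟨hwe, hw⟩),
        Tuple.numDonePreds_insert_of_sched he.1 hew]
    simp [toState, hew, hwe, hw, hready, hactive, hactive']
  · simp [Tuple.active]
  · simp [toState, hew, hwe, Tuple.mem_active_insert_iff hwe hew]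

open Classical in
theorem Config.Valid.toState_diff_component [Finite V] [LE A] (hc : c.Valid W F widen)
    (hW : W.IsWPO G) (hleave : W.LeavesOnlyFromExits) {x : X} (hx : .inr x ∈ W.active c.done) :
    Config.toState W
        ⟨c.val, c.done \ W.component x, Function.update c.phase (.inr x) .ready⟩ =
      restart W (c.toState W) x := by
  have : Finite X := hW.finite_exits
  have hinactive {w} (hw : w ∈ W.component x) (hwx : w ≠ .inr x) : w ∉ W.active c.done :=
    fun hmem => hwx (hc.isPredClosed.eq_exit_of_mem_component hmem hx hw)
  have hphase {w} (hw : w ∈ W.component x) :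
      Function.update c.phase (.inr x) .ready w = .ready := by
    obtain rfl | hwx := eq_or_ne w (.inr x)
    · exact Function.update_self ..
    · rw [Function.update_of_ne hwx, hc.ready_of_notMem_active w (hinactive hw hwx)]
  refine congrArg₂ (State.mk c.val) (funext fun w => ?_) (funext fun w => ?_) <;>
    by_cases hw : w ∈ W.component x
  · simp [hw, hphase hw,
      Tuple.numDonePreds_diff_component_of_mem hc.isPredClosed hW hx hw]
  · have hwx : w ≠ .inr x := fun heq => hw (heq ▸ hW.exit_mem_component x)
    simp [toState, hw, hwx, Tuple.numDonePreds_diff_component_of_notMem hleave hx.1 hw]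
  · have hactive : w ∈ W.active (c.done \ W.component x) ↔
        W.numOuterSchedPreds w x = W.numSchedPreds w := by
      rw [Tuple.mem_active_iff_numDonePreds_eq fun hmem => hmem.2 hw,
        Tuple.numDonePreds_diff_component_of_mem hc.isPredClosed hW hx hw]
    obtain rfl | hwx := eq_or_ne w (.inr x)
    · simp [hw, hactive]
    · have hready := hc.ready_of_notMem_active w (hinactive hw hwx)
      simp [toState, hw, hactive, hready, hwx, hinactive hw hwx]
  · have hwx : w ≠ .inr x := fun heq => hw (heq ▸ hW.exit_mem_component x)
    simp [toState, hw, hwx, Tuple.mem_active_diff_component_iff hleave hx.1 hw]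

theorem Config.Valid.step_act [Finite V] [LE A] (hc : c.Valid W F widen)
    (hW : W.IsWPO G) (hleave : W.LeavesOnlyFromExits) (he : e ∈ W.active c.done) :
    Step W F widen (c.toState W) ((c.act W F widen e).toState W) := by
  have : Finite X := hW.finite_exits
  have hphase := c.toState_phase_of_active he
  have hcnt := c.toState_cnt_of_active he
  have hsound := hc.sound e
  unfold Config.act
  generalize hp : c.phase e = p at *
  cases hsound with
  | ready e =>
    rcases e with v | x
    · exact toState_advance (p := .reset) he nofun ▸ .nonExitReset _ v hphase (hcnt rfl)
    · by_cases hx : ComponentStabilized W F c.val x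
      · rw [show nextPhase W F widen c.val (.inr x) .ready = .stabilized from if_pos hx]
        exact toState_advance (p := .stabilized) he nofun ▸
          .compStabilizedReset _ x hphase (hcnt rfl) hx
      · rw [show nextPhase W F widen c.val (.inr x) .ready = .notStabilized from if_neg hx]
        exact toState_advance (p := .notStabilized) he nofun ▸
          .compNotStabilizedReset _ x hphase (hcnt rfl) hx
  | reset v =>
    exact toState_advance_of_ne_ready (p := .evaluated _) he (hp ▸ nofun) nofun ▸
      .nonExitEval _ v hphase
  | evaluated v =>
    exact toState_advance_of_ne_ready (p := .stored) he (hp ▸ nofun) nofun ▸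
      .nonExitStore _ v _ hphase
  | stored v => exact (hc.toState_insert he (hp ▸ nofun)) ▸ .nonExitNotify _ v hphase
  | stabilized x => exact (hc.toState_insert he (hp ▸ nofun)) ▸ .compStabilizedNotify _ x hphase
  | notStabilized x =>
    exact (hc.toState_diff_component hW hleave he) ▸ .compNotStabilizedSet _ x hphase

theorem Config.active_of_toState_phase_eq {p : Phase A} (h : (c.toState W).phase e = p)
    (hp : p ≠ .idle) : e ∈ W.active c.done ∧ c.phase e = p := by
  have he : e ∈ W.active c.done := by_contra fun he => hp (h ▸ if_neg he)
  exact ⟨he, c.toState_phase_of_active he ▸ h⟩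

theorem Config.Valid.exists_act_of_step [Finite V] [LE A] (hc : c.Valid W F widen)
    (hW : W.IsWPO G) (hleave : W.LeavesOnlyFromExits) {t : State V X A}
    (h : Step W F widen (c.toState W) t) :
    ∃ e ∈ W.active c.done, (c.act W F widen e).toState W = t := by
  classical
  have : Finite X := hW.finite_exits
  have act_eq {e : V ⊕ X} {p : Phase A} (hp : c.phase e = p) :
      c.act W F widen e = ⟨nextVal c.val e p, nextDone W c.done e p,
        Function.update c.phase e (nextPhase W F widen c.val e p)⟩ := hp ▸ rfl
  cases h with
  | nonExitReset v h =>
    obtain ⟨he, hp⟩ := active_of_toState_phase_eq h nofun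
    exact ⟨_, he, act_eq hp ▸ toState_advance he nofun⟩
  | compStabilizedReset x h _ hx =>
    obtain ⟨he, hp⟩ := active_of_toState_phase_eq h nofun
    have hnext : nextPhase W F widen c.val (.inr x) .ready = .stabilized := if_pos hx
    refine ⟨_, he, ?_⟩
    rw [act_eq hp, hnext]
    exact toState_advance (p := .stabilized) he nofun
  | compNotStabilizedReset x h _ hx =>
    obtain ⟨he, hp⟩ := active_of_toState_phase_eq h nofun
    have hnext : nextPhase W F widen c.val (.inr x) .ready = .notStabilized := if_neg hx
    refine ⟨_, he, ?_⟩
    rw [act_eq hp, hnext]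
    exact toState_advance (p := .notStabilized) he nofun
  | nonExitEval v h | nonExitStore v a h =>
    obtain ⟨he, hp⟩ := active_of_toState_phase_eq h nofun
    exact ⟨_, he, act_eq hp ▸ toState_advance_of_ne_ready he (hp ▸ nofun) nofun⟩
  | nonExitNotify v h | compStabilizedNotify x h =>
    obtain ⟨he, hp⟩ := active_of_toState_phase_eq h nofun
    exact ⟨_, he, act_eq hp ▸ hc.toState_insert he (hp ▸ nofun)⟩
  | compNotStabilizedSet x h =>
    obtain ⟨he, hp⟩ := active_of_toState_phase_eq h nofun
    exact ⟨_, he, act_eq hp ▸ hc.toState_diff_component hW hleave he⟩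

theorem Config.Valid.exists_of_reflTransGen [Finite V] [Preorder A]
    (hc : c.Valid W F widen) (hW : W.IsWPO G) (hirrefl : ∀ a, ¬ W.sched a a)
    (hleave : W.LeavesOnlyFromExits) (hdep : ∀ v, DependsOn (F v) {u | G u v})
    {t : State V X A} (h : ReflTransGen (Step W F widen) (c.toState W) t) :
    ∃ d : Config V X A, d.Valid W F widen ∧ d.toState W = t := by
  induction h with
  | refl => exact ⟨c, hc, rfl⟩
  | tail _ hst ih =>
    obtain ⟨d, hd, rfl⟩ := ih
    obtain ⟨e, he, rfl⟩ := hd.exists_act_of_step hW hleave hst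
    exact ⟨_, hd.act hW hirrefl hleave hdep he, rfl⟩

theorem Config.Valid.diamondFrom_step [Finite V] [Preorder A]
    (hc : c.Valid W F widen) (hW : W.IsWPO G) (hirrefl : ∀ a, ¬ W.sched a a)
    (hleave : W.LeavesOnlyFromExits) (hdep : ∀ v, DependsOn (F v) {u | G u v}) :
    DiamondFrom (Step W F widen) (c.toState W) := by
  intro s t t' hs ht ht'
  obtain ⟨d, hd, rfl⟩ := hc.exists_of_reflTransGen hW hirrefl hleave hdep hs
  obtain ⟨e, he, rfl⟩ := hd.exists_act_of_step hW hleave ht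
  obtain ⟨e', he', rfl⟩ := hd.exists_act_of_step hW hleave ht'
  obtain rfl | hne := eq_or_ne e e'
  · exact .inl rfl
  have hact := hd.act hW hirrefl hleave hdep he
  have hact' := hd.act hW hirrefl hleave hdep he'
  refine .inr ⟨_, hact.step_act hW hleave (hd.active_act hleave he he' hne.symm), ?_⟩
  rw [hd.act_comm hW hdep he he' hne]
  exact hact'.step_act hW hleave (hd.active_act hleave he' he hne)

theorem Config.Valid.le_of_forall_not_step [Finite V] [LE A] (hc : c.Valid W F widen)
    (hW : W.IsWPO G) (hirrefl : ∀ a, ¬ W.sched a a) (hleave : W.LeavesOnlyFromExits)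
    (hstuck : ∀ t, ¬ Step W F widen (c.toState W) t) (v : V) : F v c.val ≤ c.val v := by
  have : Finite X := hW.finite_exits
  have hempty : W.active c.done = ∅ :=
    Set.eq_empty_of_forall_notMem fun e he => hstuck _ (hc.step_act hW hleave he)
  have huniv := hW.eq_univ_of_active_eq_empty hirrefl hempty
  exact le_of_forall_settled hW (fun w => hc.settled w (huniv ▸ Set.mem_univ w)) v

end Machine

section Termination

variable {V X A : Type*} {W : Tuple V X} {G : V → V → Prop} {F : V → (V → A) → A}
  {widen : A → A → A} {c : Config V X A} {e : V ⊕ X} {h v : V} {x : X}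

/-- `b` is obtained from `a` by one strictly increasing widening. -/
def WidenRel [LT A] (widen : A → A → A) (b a : A) : Prop :=
  a < b ∧ ∃ c, b = widen a c

theorem IsWidening.wellFounded [PartialOrder A] (hw : IsWidening widen) :
    WellFounded (WidenRel widen) := by
  rw [wellFounded_iff_isEmpty_descending_chain]
  refine ⟨fun ⟨f, hf⟩ => ?_⟩
  choose hlt c hc using hf
  exact hw.2 (fun n => n.casesOn (f 0) c) f rfl hc (strictMono_nat_of_lt_succ hlt)

/-- The head `h` is about to be executed or being executed, and storing its new value is going to
change its value. -/
def Config.Pending [LE A] (W : Tuple V X) (F : V → (V → A) → A) (c : Config V X A) (h : V) :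
    Prop :=
  .inl h ∈ W.active c.done ∧ c.phase (.inl h) ≠ .stored ∧ ¬ F h c.val ≤ c.val h

/-- The values at the heads of components. -/
def Config.headVal (W : Tuple V X) (c : Config V X A) (h : {v // W.IsHead v}) : A :=
  c.val h

/-- The heads that are not pending. -/
def Config.calmHeads [LE A] (W : Tuple V X) (F : V → (V → A) → A) (c : Config V X A) :
    Set {v // W.IsHead v} :=
  {h | ¬ c.Pending W F h}

/-- The number of actions left at an element in a given phase, until the rule application is
completed. -/
def Phase.remaining : Phase A → ℕ
  | .idle | .ready => 4
  | .reset => 3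
  | .evaluated _ => 2
  | .stored | .stabilized | .notStabilized => 1

open Classical in
/-- An upper bound for the number of actions until the next restart of a component. -/
noncomputable def Config.remainingWork [Fintype V] [Fintype X] (c : Config V X A) : ℕ :=
  ∑ w, if w ∈ c.done then 0 else (c.phase w).remaining

theorem subset_nextDone {D : Set (V ⊕ X)} {p : Phase A} (hp : p ≠ .notStabilized) :
    D ⊆ nextDone W D e p := by
  unfold nextDone
  split
  · exact Set.subset_insert _ _
  · exact Set.subset_insert _ _
  · exact absurd rfl hp
  · exact subset_rfl

open Classical in
theorem remaining_nextPhase_lt [LE A] {Y : V → A} {D : Set (V ⊕ X)} {p : Phase A}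
    (hsound : SoundPhase W F widen Y e p) (hp : p ≠ .notStabilized) :
    (if e ∈ nextDone W D e p then 0 else (nextPhase W F widen Y e p).remaining) <
      p.remaining := by
  cases hsound with
  | ready e =>
    rcases e with v | x <;> simp only [nextPhase] <;> split_ifs <;> simp [Phase.remaining]
  | reset | evaluated => simp only [nextPhase]; split_ifs <;> simp [Phase.remaining]
  | stored | stabilized => simp [nextDone, Phase.remaining]
  | notStabilized => exact absurd rfl hp

theorem Config.Valid.remainingWork_act_lt [Fintype V] [Fintype X] [LE A]
    (hc : c.Valid W F widen) (he : e ∈ W.active c.done) (hp : c.phase e ≠ .notStabilized) :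
    (c.act W F widen e).remainingWork < c.remainingWork := by
  classical
  have hlt := remaining_nextPhase_lt (D := c.done) (hc.sound e) hp
  refine Finset.sum_lt_sum (fun w _ => ?_) ⟨e, Finset.mem_univ e, ?_⟩
  · obtain rfl | hne := eq_or_ne w e
    · simpa [Config.act, he.1] using hlt.le
    · rw [act_phase_of_ne hne]
      by_cases hw : w ∈ c.done
      · simp [Config.act, subset_nextDone hp hw]
      · rw [if_neg hw]
        split_ifs <;> simp
  · simpa [Config.act, he.1] using hlt

theorem Config.Valid.pending_act_of_ne [LE A] (hc : c.Valid W F widen) (hW : W.IsWPO G)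
    (hleave : W.LeavesOnlyFromExits) (hdep : ∀ v, DependsOn (F v) {u | G u v})
    (he : e ∈ W.active c.done) (hne : .inl h ≠ e) (hh : c.Pending W F h) :
    (c.act W F widen e).Pending W F h := by
  obtain ⟨hactive, hphase, hF⟩ := hh
  refine ⟨hc.active_act hleave he hactive hne, by rwa [act_phase_of_ne hne], ?_⟩
  have hle := hc.not_le he hactive hne.symm
  have hle' := hc.not_le hactive he hne
  simpa only [Config.act, nextVal_apply_of_ne hne.symm, apply_nextVal hW hdep hle hle'] using hF

theorem Config.Valid.pending_act_of_notStabilized [LE A] (hc : c.Valid W F widen)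
    (hW : W.IsWPO G) (hirrefl : ∀ a, ¬ W.sched a a) (hxh : W.stab x h)
    (hx : .inr x ∈ W.active c.done) (hp : c.phase (.inr x) = .notStabilized) :
    ¬ c.Pending W F h ∧ (c.act W F widen (.inr x)).Pending W F h := by
  have hdone : .inl h ∈ c.done :=
    hc.isPredClosed.mem_of_le_active hx (hW.head_le_exit hxh) Sum.inl_ne_inr
  have hready : c.phase (.inl h) = .ready :=
    hc.ready_of_notMem_active _ fun hactive => hactive.1 hdone
  have hunsettled : ¬ ComponentStabilized W F c.val x := by
    have := hc.sound (.inr x)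
    rw [hp] at this
    cases this with | notStabilized _ hx => exact hx
  refine ⟨fun hpend => hpend.1.1 hdone, ?_, ?_, ?_⟩
  · simpa only [Config.act, hp, nextDone] using
      hc.isPredClosed.head_active_diff_component hW hirrefl hx hxh
  · rw [act_phase_of_ne Sum.inl_ne_inr, hready]
    nofun
  · simpa only [Config.act, nextVal, componentStabilized_iff hW hxh] using hunsettled

/-- The lexicographic progress measure: a store at a head strictly widens its value or leaves all
values at heads alone, a restart makes the head of its component pending, and every other action
decreases the remaining work without ending a pending state. -/
noncomputable def Config.measure [Fintype V] [Fintype X] [LE A] (W : Tuple V X)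
    (F : V → (V → A) → A) (c : Config V X A) : ({v // W.IsHead v} → A) × ℕ × ℕ :=
  (c.headVal W, (c.calmHeads W F).ncard, c.remainingWork)

/-- The relation in which the measure decreases. An action changes the value at only one head, so
the values at heads may be compared along an arbitrary well-order of the heads. -/
def MeasureRel [LT A] (W : Tuple V X) (widen : A → A → A) :
    ({v // W.IsHead v} → A) × ℕ × ℕ → ({v // W.IsHead v} → A) × ℕ × ℕ → Prop :=
  Prod.Lex (Pi.Lex WellOrderingRel fun {_} => WidenRel widen) (Prod.Lex (· < ·) (· < ·))

theorem IsWidening.wellFounded_measureRel [Finite V] [PartialOrder A] (hw : IsWidening widen) :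
    WellFounded (MeasureRel W widen) :=
  (Pi.Lex.wellFounded _ fun _ => hw.wellFounded).prod_lex (wellFounded_lt.prod_lex wellFounded_lt)

theorem Config.Valid.measureRel_act_of_headVal_eq [Fintype V] [Fintype X] [Preorder A]
    (hc : c.Valid W F widen) (hW : W.IsWPO G)
    (hleave : W.LeavesOnlyFromExits) (hdep : ∀ v, DependsOn (F v) {u | G u v})
    (he : e ∈ W.active c.done) (hp : c.phase e ≠ .notStabilized)
    (hval : (c.act W F widen e).headVal W = c.headVal W)
    (hpending : ∀ v, W.IsHead v → e = .inl v → c.Pending W F v →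
      (c.act W F widen e).Pending W F v) :
    MeasureRel W widen ((c.act W F widen e).measure W F) (c.measure W F) := by
  have hsub : (c.act W F widen e).calmHeads W F ⊆ c.calmHeads W F := by
    refine fun h hcalm hpend => hcalm ?_
    by_cases hhe : e = .inl h.1
    · exact hpending h h.2 hhe hpend
    · exact hc.pending_act_of_ne hW hleave hdep he (Ne.symm hhe) hpend
  rw [measure, measure, hval]
  refine .right _ ?_
  obtain hlt | heq := (Set.ncard_le_ncard hsub (Set.toFinite _)).lt_or_eq
  · exact .left _ _ hlt
  · exact heq ▸ .right _ (hc.remainingWork_act_lt he hp)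

theorem Config.Valid.measureRel_act_of_notStabilized [Fintype V] [Fintype X] [Preorder A]
    (hc : c.Valid W F widen) (hW : W.IsWPO G) (hirrefl : ∀ a, ¬ W.sched a a)
    (hleave : W.LeavesOnlyFromExits) (hdep : ∀ v, DependsOn (F v) {u | G u v})
    (hx : .inr x ∈ W.active c.done) (hp : c.phase (.inr x) = .notStabilized) :
    MeasureRel W widen ((c.act W F widen (.inr x)).measure W F) (c.measure W F) := by
  obtain ⟨h, hxh⟩ := hW.exit_has_head x
  obtain ⟨hcalm, hpend⟩ := hc.pending_act_of_notStabilized hW hirrefl hxh hx hp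
  refine .right _ (.left _ _ (Set.ncard_lt_ncard ⟨fun k hk hpendk => hk ?_, fun hsub => ?_⟩))
  · exact hc.pending_act_of_ne hW hleave hdep hx Sum.inl_ne_inr hpendk
  · exact hsub (show ⟨h, x, hxh⟩ ∈ c.calmHeads W F from hcalm) hpend

open Classical in
theorem measureRel_of_widenRel [Fintype V] [Fintype X] [Preorder A] {d : Config V X A}
    (hh : W.IsHead h) (hval : d.val = Function.update c.val h (d.val h))
    (hlt : WidenRel widen (d.val h) (c.val h)) :
    MeasureRel W widen (d.measure W F) (c.measure W F) := by
  refine .left _ _ ⟨⟨h, hh⟩, fun k hk => ?_, hlt⟩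
  have hne : k.1 ≠ h := by
    rintro rfl
    exact irrefl_of WellOrderingRel k hk
  change d.val k = c.val k
  rw [hval, Function.update_of_ne hne]

theorem Config.Valid.measureRel_act_of_evaluated [Fintype V] [Fintype X] [PartialOrder A]
    (hc : c.Valid W F widen) (hw : IsWidening widen) (hW : W.IsWPO G)
    (hleave : W.LeavesOnlyFromExits) (hdep : ∀ v, DependsOn (F v) {u | G u v})
    (hh : W.IsHead h) (he : .inl h ∈ W.active c.done)
    (hp : c.phase (.inl h) = .evaluated (widen (c.val h) (F h c.val))) :
    MeasureRel W widen ((c.act W F widen (.inl h)).measure W F) (c.measure W F) := by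
  classical
  have hval : (c.act W F widen (.inl h)).val =
      Function.update c.val h (widen (c.val h) (F h c.val)) := by
    simp only [Config.act, hp, nextVal]
  obtain ⟨hle, hFle⟩ := hw.1 (c.val h) (F h c.val)
  obtain hlt | heq := hle.lt_or_eq
  · refine measureRel_of_widenRel (d := c.act W F widen (.inl h)) hh ?_ ?_
    · rw [hval, Function.update_self]
    · rw [hval, Function.update_self]
      exact ⟨hlt, _, rfl⟩
  · refine hc.measureRel_act_of_headVal_eq hW hleave hdep he (hp ▸ nofun) ?_ ?_
    · rw [← heq, Function.update_eq_self] at hval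
      exact funext fun k => congrFun hval k
    · rintro v - hv ⟨-, -, hF⟩
      obtain rfl := Sum.inl.inj hv
      exact absurd (hFle.trans_eq heq.symm) hF

theorem Config.Valid.measureRel_act [Fintype V] [Fintype X] [PartialOrder A]
    (hc : c.Valid W F widen) (hw : IsWidening widen) (hW : W.IsWPO G)
    (hirrefl : ∀ a, ¬ W.sched a a) (hleave : W.LeavesOnlyFromExits)
    (hdep : ∀ v, DependsOn (F v) {u | G u v}) (he : e ∈ W.active c.done) :
    MeasureRel W widen ((c.act W F widen e).measure W F) (c.measure W F) := by
  classical
  have of_val_eq (hp : c.phase e ≠ .notStabilized) (hval : (c.act W F widen e).val = c.val)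
      (hpending : ∀ v, e = .inl v → c.Pending W F v → (c.act W F widen e).Pending W F v) :=
    hc.measureRel_act_of_headVal_eq hW hleave hdep he hp
      (funext fun k => congrFun hval k) fun v _ => hpending v
  have hsound := hc.sound e
  generalize hp : c.phase e = p at hsound
  have hact : c.act W F widen e = ⟨nextVal c.val e p, nextDone W c.done e p,
      Function.update c.phase e (nextPhase W F widen c.val e p)⟩ := hp ▸ rfl
  cases hsound with
  | ready e =>
    rcases e with v | x
    · refine of_val_eq (hp ▸ nofun) (hact ▸ rfl) ?_
      rintro _ ⟨⟩ ⟨hactive, -, hF⟩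
      exact hact ▸ ⟨hactive, by simp [nextPhase], hF⟩
    · exact of_val_eq (hp ▸ nofun) (hact ▸ rfl) nofun
  | reset v =>
    refine of_val_eq (hp ▸ nofun) (hact ▸ rfl) ?_
    rintro _ ⟨⟩ ⟨hactive, -, hF⟩
    exact hact ▸ ⟨hactive, by simp [nextPhase], hF⟩
  | evaluated v =>
    by_cases hv : W.IsHead v
    · have hnew : newValue W F widen c.val v = widen (c.val v) (F v c.val) := if_pos hv
      exact hc.measureRel_act_of_evaluated hw hW hleave hdep hv he (hnew ▸ hp)
    · refine hc.measureRel_act_of_headVal_eq hW hleave hdep he (hp ▸ nofun) ?_ ?_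
      · exact funext fun k => nextVal_apply_of_ne fun hvk => hv (Sum.inl.inj hvk ▸ k.2)
      · rintro _ hhead ⟨⟩
        exact absurd hhead hv
  | stored v =>
    refine of_val_eq (hp ▸ nofun) (hact ▸ rfl) ?_
    rintro _ ⟨⟩ ⟨-, hstored, -⟩
    exact absurd hp hstored
  | stabilized x => exact of_val_eq (hp ▸ nofun) (hact ▸ rfl) nofun
  | notStabilized x => exact hc.measureRel_act_of_notStabilized hW hirrefl hleave hdep he hp

theorem Config.Valid.acc [Finite V] [PartialOrder A] (hw : IsWidening widen)
    (hc : c.Valid W F widen) (hW : W.IsWPO G) (hirrefl : ∀ a, ¬ W.sched a a)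
    (hleave : W.LeavesOnlyFromExits) (hdep : ∀ v, DependsOn (F v) {u | G u v}) :
    Acc (flip (Step W F widen)) (c.toState W) := by
  have : Finite X := hW.finite_exits
  have := Fintype.ofFinite V
  have := Fintype.ofFinite X
  generalize hm : c.measure W F = m
  induction m using (hw.wellFounded_measureRel (W := W)).induction generalizing c with
  | h m ih =>
    subst hm
    refine ⟨_, fun t ht => ?_⟩
    obtain ⟨e, he, rfl⟩ := hc.exists_act_of_step hW hleave ht
    exact ih _ (hc.measureRel_act hw hW hirrefl hleave hdep he)
      (hc.act hW hirrefl hleave hdep he) rfl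

theorem not_hasInfiniteExecution_of_acc [LE A] [BoundedOrder A] {entry : Set V}
    (h : Acc (flip (Step W F widen)) (init W entry)) : ¬ HasInfiniteExecution W F widen entry :=
  fun ⟨r, hr, hstep⟩ => (acc_iff_isEmpty_descending_chain.1 h).false ⟨r, hr, hstep⟩

end Termination

end ConcFix

open ConcFix in
theorem mainTheorem1_general {V X A : Type*} [Finite V] [PartialOrder A] [BoundedOrder A]
    (G : V → V → Prop) (W : Tuple V X) (hW : W.IsWPO G) (hirrefl : ∀ a, ¬ W.sched a a)
    (hleave : W.LeavesOnlyFromExits) (F : V → (V → A) → A)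
    (hdep : ∀ v, DependsOn (F v) {u | G u v}) (widen : A → A → A) (entry : Set V) :
    (∃ Y : V → A, (∀ v, F v Y ≤ Y v) ∧ ∀ s, IsFinal W F widen entry s → s.val = Y) ∧
    ((∃ s, IsFinal W F widen entry s) → ¬ HasInfiniteExecution W F widen entry) ∧
    (IsWidening widen → ¬ HasInfiniteExecution W F widen entry) := by
  have : Finite X := hW.finite_exits
  have hstart : (Config.start entry : Config V X A).Valid W F widen := .start
  have hinit : (Config.start entry : Config V X A).toState W = init W entry :=
    Config.toState_start
  have hdiamond := hstart.diamondFrom_step hW hirrefl hleave hdep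
  have hacc (hw : IsWidening widen) := hstart.acc hw hW hirrefl hleave hdep
  rw [hinit] at hdiamond hacc
  refine ⟨?_, ?_, fun hw => not_hasInfiniteExecution_of_acc (hacc hw)⟩
  · by_cases hfinal : ∃ s, IsFinal W F widen entry s
    · obtain ⟨s, hs, hstuck⟩ := hfinal
      obtain ⟨c, hc, rfl⟩ :=
        hstart.exists_of_reflTransGen hW hirrefl hleave hdep (hinit.symm ▸ hs)
      exact ⟨_, hc.le_of_forall_not_step hW hirrefl hleave hstuck,
        fun t ht => congrArg State.val (hdiamond.eq_of_normal ht.1 ht.2 hs hstuck)⟩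
    · exact ⟨⊤, fun _ => le_top, fun s hs => absurd ⟨s, hs⟩ hfinal⟩
  · rintro ⟨s, hs, hstuck⟩
    exact not_hasInfiniteExecution_of_acc
      (hdiamond.acc_of_reflTransGen hs ⟨_, fun t ht => absurd ht (hstuck t)⟩)

theorem mainTheorem1 {V X A : Type*} [Finite V] [Finite X] [CompleteLattice A]
    (G : V → V → Prop) (W : ConcFix.Tuple V X) (hW : W.IsWPO G)
    (hirrefl : ∀ a, ¬ W.sched a a)
    (hleave : ∀ (x : X) (u v : V ⊕ X),
      u ∈ W.component x → u ≠ Sum.inr x → W.sched u v → v ∈ W.component x)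
    (F : V → (V → A) → A) (hmono : ∀ v, Monotone (F v))
    (hdep : ∀ (v : V) (Y Z : V → A), (∀ u, G u v → Y u = Z u) → F v Y = F v Z)
    (widen : A → A → A) (entry : Set V) :
    (∃ Y : V → A,
      (∀ v, F v Y ≤ Y v) ∧
      OrderHom.lfp (ConcFix.systemMap F hmono) ≤ Y ∧
      ∀ s, ConcFix.IsFinal W F widen entry s → s.val = Y) ∧
    ((∃ s, ConcFix.IsFinal W F widen entry s) →
      ¬ ConcFix.HasInfiniteExecution W F widen entry) ∧
    (ConcFix.IsWidening widen → ¬ ConcFix.HasInfiniteExecution W F widen entry) := by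
  obtain ⟨⟨Y, hY, hfinal⟩, hfinite, hwiden⟩ :=
    mainTheorem1_general G W hW hirrefl hleave F (fun v Y Z h => hdep v Y Z h) widen entry
  exact ⟨⟨Y, hY, OrderHom.lfp_le _ hY, hfinal⟩, hfinite, hwiden⟩
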